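/- Let $\pi\colon\mathcal M\to A$ be a (topological, locally trivial) fiber bundle over a topological space $A$, and assume that every fiber $M_a=\pi^{-1}(a)$, $a\in A$, with its subspace topology, carries the structure of a finite-dimensional manifold of class $C^1$. Let $N$ be a (possibly infinite-dimensional) real Banach manifold without boundary, of class $C^1$, modelled on a Banach space $E$, and let $Q\subset N$ be a Banach submanifold of class $C^1$; that is, each point of $Q$ lies in the domain $U$ of a $C^1$-compatible chart $\varphi\colon U\to E$ of $N$ such that $\varphi(Q\cap U)=\varphi(U)\cap F$ for some closed linear subspace $F\subset E$. (In particular, all objects may be smooth, and $F$ may be complemented.) For $q\in Q$, let $T_qQ\subset T_qN$ be the tangent space of $Q$, i.e. the set of velocities at $q$ of $C^1$ curves in $N$ that pass through $q$ and lie in $Q$. Let $\chi\colon\mathcal M\to N$ be a continuous map, and suppose that there are $a_0\in A$ and $p_0\in M_{a_0}$ such that (a) $\chi(p_0)\in Q$; (b) the restriction $\chi_{a_0}=\chi|_{M_{a_0}}\colon M_{a_0}\to N$ is of class $C^1$; (c) $\mathrm d\chi_{a_0}(p_0)\big(T_{p_0}M_{a_0}\big)+T_{\chi(p_0)}Q=T_{\chi(p_0)}N$.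 Then there is a neighborhood $W$ of $a_0$ in $A$ such that $\chi(M_a)\cap Q\neq\emptyset$ for every $a\in W$. -/

import Mathlib

open Set Filter Topology Manifold ContDiff Bundle
open scoped Pointwise

/-- `Q` is a Banach submanifold, of class `C^k`, of the Banach manifold `N` modelled on `E`:
around each point of `Q` there is a chart `φ` of the (maximal) `C^k` atlas of `N` in which `Q` is a
closed linear subspace `F` of `E`, that is, `φ (Q ∩ φ.source) = F ∩ φ.target`. Submanifolds for
which `F` is moreover complemented in `E` are a special case. -/
def IsBanachSubmanifold {E : Type*} [NormedAddCommGroup E] [NormedSpace ℝ E]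
    (k : ℕ∞ω) {N : Type*} [TopologicalSpace N] [ChartedSpace E N] (Q : Set N) : Prop :=
  ∀ q ∈ Q, ∃ φ ∈ IsManifold.maximalAtlas 𝓘(ℝ, E) k N, q ∈ φ.source ∧
    ∃ F : Submodule ℝ E, IsClosed (F : Set E) ∧ ∀ x ∈ φ.source, x ∈ Q ↔ φ x ∈ F

/-- The tangent space `T_q Q`, as a subset of `T_q N`: the velocities at time `0` of the curves
in `N` that are `C^1` near time `0`, pass through `q` at time `0`, and stay in `Q` near time `0`. -/
def submanifoldTangentSpace {E : Type*} [NormedAddCommGroup E] [NormedSpace ℝ E]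
    {N : Type*} [TopologicalSpace N] [ChartedSpace E N] (Q : Set N) (q : N) :
    Set (TangentSpace 𝓘(ℝ, E) q) :=
  {v | ∃ γ : ℝ → N, γ 0 = q ∧ ContMDiffAt 𝓘(ℝ, ℝ) 𝓘(ℝ, E) 1 γ 0 ∧ (∀ᶠ t in 𝓝 0, γ t ∈ Q) ∧
    mfderiv 𝓘(ℝ, ℝ) 𝓘(ℝ, E) γ 0 (1 : ℝ) = v}

/-!
In a chart of `N` that flattens `Q` to a closed subspace `G` of the model space `E`, the map `χ`
meets `Q` exactly where its component in `E ⧸ G` vanishes. Transversality at `p₀` says that the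
derivative of this component along the fiber `M a₀` is surjective onto `E ⧸ G`. So `E ⧸ G` has
finite dimension, even though `E` and `G` may not, and no complement of `G` is needed. A local
trivialization of the bundle and a chart of `M a₀` turn the component into a continuous family, with
parameter `a`, of maps from an open subset of `V` to `E ⧸ G`. It remains to see that a zero with
surjective derivative persists under a perturbation that is only continuous
(`eventually_exists_eq_zero_of_hasFDerivAt_surjective`). For lack of differentiability at `a ≠ a₀`
the implicit function theorem is of no use here. After restriction to the image of a right inverse
of the derivative, the map for `a₀` is close to the identity on a small ball, hence so are the maps
for nearby `a`, and a form of Brouwer's theorem (`exists_eq_zero_of_continuousOn_closedBall`) gives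
the zero.

Brouwer's theorem is proved by volumes, in the manner of Milnor and Rogers. For a Lipschitz `u` that
vanishes off an open set `s` of finite measure, the integral over `s` of the Jacobian of
`x ↦ x + r u(x)` is the volume of `s` for small `r > 0`, by the change of variables formula; as it
is polynomial in `r`, it is the volume of `s` for `r = 1` as well (`setIntegral_det_one_add_fderiv`).
A retraction of the ball onto its boundary sphere would have Jacobian zero, a contradiction.
-/

section

open MeasureTheory Metric

/-! ### Volume and perturbations of the identity -/

/-- A polynomial `r ↦ det (1 + r A)` of bounded degree is determined by its values on `(0, ε)`, and
its value at `1` is a fixed linear combination, with weights of sum `1`, of its values at finitely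
many nodes there. The nodes and the weights do not depend on `A`, so that the identity can be
integrated over a family of operators. -/
theorem exists_det_one_add_eq_sum {X : Type*} [NormedAddCommGroup X] [NormedSpace ℝ X]
    [FiniteDimensional ℝ X] {ε : ℝ} (hε : 0 < ε) :
    ∃ (s : Finset ℕ) (t c : ℕ → ℝ), (∀ i ∈ s, t i ∈ Ioo 0 ε) ∧ ∑ i ∈ s, c i = 1 ∧
      ∀ A : X →L[ℝ] X, (1 + A).det = ∑ i ∈ s, c i * (1 + t i • A).det := by
  let n := Module.finrank ℝ X
  let b := Module.finBasis ℝ X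
  let s := Finset.range (n + 1)
  let t : ℕ → ℝ := fun i => ε / (i + 2)
  have ht : Set.InjOn t s := by
    intro i _ j _ hij
    have h1 : (0 : ℝ) < i + 2 := by positivity
    have h2 : (0 : ℝ) < j + 2 := by positivity
    simp only [t] at hij
    rw [div_eq_div_iff h1.ne' h2.ne'] at hij
    have := mul_left_cancel₀ hε.ne' hij
    exact_mod_cast (add_right_cancel this).symm
  refine ⟨s, t, fun i => (Lagrange.basis s t i).eval 1, ?_, ?_, ?_⟩
  · intro i _
    refine ⟨by positivity, div_lt_self hε ?_⟩
    have : (0 : ℝ) ≤ i := by positivity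
    linarith
  · rw [← Polynomial.eval_finsetSum, Lagrange.sum_basis ht ⟨0, by simp [s]⟩, Polynomial.eval_one]
  · intro A
    let B := LinearMap.toMatrix b b (A : X →ₗ[ℝ] X)
    -- The polynomial `r ↦ det (1 + r A)`, of degree at most `n`: it is interpolated at the
    -- `n + 1` nodes.
    let p : Polynomial ℝ := (((Polynomial.X : Polynomial ℝ) • B.map Polynomial.C +
      (1 : Matrix _ _ ℝ).map Polynomial.C).det)
    have hp : ∀ r : ℝ, p.eval r = (1 + r • A).det := by
      intro r
      have h1 : (1 + r • A).det = LinearMap.det ((1 : X →ₗ[ℝ] X) + r • (A : X →ₗ[ℝ] X)) := rfl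
      rw [h1, ← LinearMap.det_toMatrix b, map_add, map_smul, LinearMap.toMatrix_one, add_comm]
      simp only [p]
      rw [← Polynomial.coe_evalRingHom, RingHom.map_det]
      congr 1
      ext i j
      by_cases hij : i = j <;> simp [B, hij] <;> ring
    have hdeg : p.degree < (s.card : WithBot ℕ) := by
      have h := Polynomial.natDegree_det_X_add_C_le B 1
      rw [Fintype.card_fin] at h
      refine (Polynomial.degree_le_natDegree).trans_lt ?_
      simp only [s, Finset.card_range]
      exact_mod_cast Nat.lt_succ_of_le h
    have h1 := hp 1
    rw [one_smul, Lagrange.eq_interpolate (v := t) ht hdeg, Lagrange.interpolate_apply,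
      Polynomial.eval_finsetSum] at h1
    rw [← h1]
    refine Finset.sum_congr rfl fun i _ => ?_
    simp only [Polynomial.eval_mul, Polynomial.eval_C, hp]
    ring

theorem det_one_add_nonneg_of_norm_lt_one {X : Type*} [NormedAddCommGroup X] [NormedSpace ℝ X]
    [FiniteDimensional ℝ X] {A : X →L[ℝ] X} (hA : ‖A‖ < 1) : 0 ≤ (1 + A).det := by
  have : CompleteSpace X := FiniteDimensional.complete ℝ X
  by_contra! h
  have hc : Continuous fun r : ℝ => (1 + r • A).det := by
    have : Continuous fun B : X →L[ℝ] X => B.det := ContinuousLinearMap.continuous_det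
    exact this.comp (by fun_prop)
  obtain ⟨r, hr, h0⟩ : (0 : ℝ) ∈ (fun r : ℝ => (1 + r • A).det) '' Icc 0 1 := by
    refine intermediate_value_Icc' zero_le_one hc.continuousOn ⟨by simpa using h.le, ?_⟩
    have : (1 : X →L[ℝ] X).det = 1 := LinearMap.det_id
    simp [this]
  -- A zero of the determinant on `[0, 1]` contradicts the invertibility of `1 + r A`.
  have hu : IsUnit (1 - (-(r • A))) := by
    apply isUnit_one_sub_of_norm_lt_one
    rw [norm_neg, norm_smul, Real.norm_of_nonneg hr.1]
    nlinarith [hr.2, norm_nonneg A]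
  rw [sub_neg_eq_add] at hu
  have h2 : IsUnit (LinearMap.det ((1 + r • A : X →L[ℝ] X) : X →ₗ[ℝ] X)) :=
    LinearMap.isUnit_det _ (hu.map (ContinuousLinearMap.toLinearMapRingHom))
  exact h2.ne_zero h0

theorem bijective_id_add_of_lipschitzWith {X : Type*} [NormedAddCommGroup X] [NormedSpace ℝ X]
    [CompleteSpace X] {u : X → X} {K : NNReal} (hu : LipschitzWith K u) (hK : K < 1) :
    Function.Bijective fun x => x + u x := by
  have h : ApproximatesLinearOn (fun x => x + u x)
      ((ContinuousLinearEquiv.refl ℝ X : X ≃L[ℝ] X) : X →L[ℝ] X) univ K := by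
    rw [ApproximatesLinearOn.approximatesLinearOn_iff_lipschitzOnWith, lipschitzOnWith_univ]
    convert hu using 1
    ext x; simp
  have h' : Subsingleton X ∨ K < ‖((ContinuousLinearEquiv.refl ℝ X : X ≃L[ℝ] X).symm :
      X →L[ℝ] X)‖₊⁻¹ := by
    rcases subsingleton_or_nontrivial X with h | h
    · exact Or.inl h
    · right
      have : ‖((ContinuousLinearEquiv.refl ℝ X : X ≃L[ℝ] X).symm : X →L[ℝ] X)‖₊ = 1 := by
        ext
        exact ContinuousLinearMap.norm_id
      rwa [this, inv_one]
  exact ⟨injOn_univ.1 (h.injOn h'), h.surjective h'⟩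

/-- A Lipschitz perturbation of the identity that is supported in the open set `s` preserves the
signed volume of `s`. For small `r > 0` the map `x ↦ x + r u(x)` is a bijection that maps `s` onto
itself and has nonnegative Jacobian, so the change of variables formula applies; both sides are
polynomial in `r`, hence the formula persists at `r = 1`, where the map need not be injective. -/
theorem setIntegral_det_one_add_fderiv {X : Type*} [NormedAddCommGroup X] [NormedSpace ℝ X]
    [FiniteDimensional ℝ X] [MeasurableSpace X] [BorelSpace X] (μ : Measure X) [μ.IsAddHaarMeasure]
    {u : X → X} {K : NNReal} (hu : LipschitzWith K u) {s : Set X} (hs : IsOpen s)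
    (hμs : μ s ≠ ⊤) (hus : ∀ x ∉ s, u x = 0) (hd : DifferentiableOn ℝ u s) :
    ∫ x in s, (1 + fderiv ℝ u x).det ∂μ = μ.real s := by
  have : CompleteSpace X := FiniteDimensional.complete ℝ X
  -- Any `r < 1 / (K + 1)` makes `r • u` a contraction, also when `K = 0`.
  have hε : (0 : ℝ) < (K + 1 : ℝ)⁻¹ := by positivity
  obtain ⟨T, t, c, ht, hc, hdet⟩ := exists_det_one_add_eq_sum (X := X) hε
  have key : ∀ r ∈ Ioo (0 : ℝ) (K + 1 : ℝ)⁻¹,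
      IntegrableOn (fun x => (1 + r • fderiv ℝ u x).det) s μ ∧
      ∫ x in s, (1 + r • fderiv ℝ u x).det ∂μ = μ.real s := by
    intro r hr
    have hrK : r * K < 1 := by
      have h1 := mul_lt_mul_of_pos_right hr.2 (by positivity : (0 : ℝ) < K + 1)
      rw [inv_mul_cancel₀ (by positivity)] at h1
      nlinarith [hr.1]
    have hLip : LipschitzWith (r.toNNReal * K) (fun x => r • u x) := by
      refine LipschitzWith.of_dist_le_mul fun x y => ?_
      rw [dist_smul₀, NNReal.coe_mul, Real.coe_toNNReal _ hr.1.le, Real.norm_of_nonneg hr.1.le,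
        mul_assoc]
      exact mul_le_mul_of_nonneg_left (hu.dist_le_mul x y) hr.1.le
    have hbij := bijective_id_add_of_lipschitzWith hLip (by
      rw [← NNReal.coe_lt_coe, NNReal.coe_mul, Real.coe_toNNReal _ hr.1.le]; exact hrK)
    set f : X → X := fun x => x + r • u x with hf
    have hfix : ∀ x ∉ s, f x = x := fun x hx => by simp [hf, hus x hx]
    -- `f` is a bijection that fixes the complement of `s` pointwise.
    have himg : f '' s = s := by
      have h1 : f '' sᶜ = sᶜ := (image_congr hfix).trans (image_id _)
      have h2 := image_compl_eq hbij (s := s)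
      rw [h1] at h2
      exact (compl_injective h2).symm
    have hder : ∀ x ∈ s, HasFDerivWithinAt f (1 + r • fderiv ℝ u x) s x := by
      intro x hx
      have h1 : HasFDerivAt u (fderiv ℝ u x) x :=
        ((hd x hx).differentiableAt (hs.mem_nhds hx)).hasFDerivAt
      exact ((hasFDerivAt_id x).add (h1.const_smul r)).hasFDerivWithinAt
    -- The Jacobian is nonnegative, so the unsigned change of variables formula is the signed one.
    have habs : ∀ x, |(1 + r • fderiv ℝ u x).det| = (1 + r • fderiv ℝ u x).det := by
      intro x
      refine abs_of_nonneg (det_one_add_nonneg_of_norm_lt_one ?_)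
      rw [norm_smul, Real.norm_of_nonneg hr.1.le]
      exact (mul_le_mul_of_nonneg_left (norm_fderiv_le_of_lipschitz ℝ hu) hr.1.le).trans_lt hrK
    have hintegrable := integrableOn_image_iff_integrableOn_abs_det_fderiv_smul μ hs.measurableSet
      hder hbij.1.injOn (fun _ => (1 : ℝ))
    have hval := integral_image_eq_integral_abs_det_fderiv_smul μ hs.measurableSet hder
      hbij.1.injOn (fun _ => (1 : ℝ))
    simp only [habs, smul_eq_mul, mul_one, himg] at hintegrable hval
    refine ⟨hintegrable.1 (integrableOn_const hμs), ?_⟩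
    rw [← hval]
    simp
  rw [integral_congr_ae (.of_forall fun x => hdet (fderiv ℝ u x))]
  rw [integral_finsetSum _ fun i hi => ((key _ (ht i hi)).1.const_mul (c i))]
  rw [Finset.sum_congr rfl fun i hi => by rw [integral_const_mul, (key _ (ht i hi)).2]]
  rw [← Finset.sum_mul, hc, one_mul]

/-! ### Zeros of maps close to the identity -/

theorem lipschitzWith_of_lipschitzOnWith_closedBall {X Y : Type*} [NormedAddCommGroup X]
    [NormedSpace ℝ X] [NormedAddCommGroup Y] {u : X → Y} {K : NNReal} {r : ℝ}
    (hu : LipschitzOnWith K u (closedBall 0 r)) (h0 : ∀ x, r ≤ ‖x‖ → u x = 0) :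
    LipschitzWith K u := by
  have key : ∀ x y, ‖x‖ ≤ r → r ≤ ‖y‖ → dist (u x) (u y) ≤ K * dist x y := by
    intro x y hx hy
    -- The segment from `x` to `y` crosses the sphere, where `u` vanishes already.
    obtain ⟨c, hc, hcr⟩ : r ∈ (fun c : ℝ => ‖AffineMap.lineMap x y c‖) '' Icc 0 1 := by
      refine intermediate_value_Icc zero_le_one ?_ ⟨by simpa using hx, by simpa using hy⟩
      exact AffineMap.lineMap_continuous.norm.continuousOn
    simp only at hcr
    rw [h0 y hy, ← h0 _ hcr.ge]
    refine (hu.dist_le_mul _ (by simpa using hx) _ (by simpa using hcr.le)).trans ?_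
    gcongr
    rw [dist_left_lineMap, Real.norm_of_nonneg hc.1]
    exact mul_le_of_le_one_left dist_nonneg hc.2
  refine LipschitzWith.of_dist_le_mul fun x y => ?_
  rcases le_total ‖x‖ r with hx | hx <;> rcases le_total ‖y‖ r with hy | hy
  · exact hu.dist_le_mul _ (by simpa using hx) _ (by simpa using hy)
  · exact key x y hx hy
  · rw [dist_comm, dist_comm x]
    exact key y x hy hx
  · rw [h0 x hx, h0 y hy, dist_self]
    positivity

theorem det_fderiv_eq_zero_of_norm_eq_one {X : Type*} [NormedAddCommGroup X]
    [InnerProductSpace ℝ X] [FiniteDimensional ℝ X] {f : X → X} {f' : X →L[ℝ] X} {x : X}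
    (hf : HasFDerivAt f f' x) (h : ∀ y, ‖f y‖ = 1) : f'.det = 0 := by
  by_contra hdet
  have horth : ∀ w, inner ℝ (f x) (f' w) = 0 := by
    intro w
    have h1 := hf.norm_sq
    have h2 : HasFDerivAt (fun y => ‖f y‖ ^ 2) (0 : X →L[ℝ] ℝ) x := by
      simp only [h]
      exact hasFDerivAt_const _ _
    have h3 := congrArg (fun A : X →L[ℝ] ℝ => A w) (h1.unique h2)
    simpa using h3
  obtain ⟨w, hw⟩ := ((f' : X →ₗ[ℝ] X).equivOfDetNeZero hdet).surjective (f x)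
  have h1 := horth w
  have h2 : f' w = f x := hw
  rw [h2, real_inner_self_eq_norm_sq, h x] at h1
  norm_num at h1

/-- A `C¹` self-map of Euclidean space that is the identity off the unit ball has a zero. Otherwise
`h / ‖h‖` would be a `C¹` retraction of the ball onto the sphere; its Jacobian vanishes identically,
while its integral over the ball has to be the volume of the ball. -/
theorem exists_eq_zero_of_contDiff {X : Type*} [NormedAddCommGroup X]
    [InnerProductSpace ℝ X] [FiniteDimensional ℝ X] {h : X → X} (hd : ContDiff ℝ 1 h)
    (hid : ∀ x, 1 ≤ ‖x‖ → h x = x) : ∃ x, h x = 0 := by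
  by_contra! h0
  borelize X
  let ρ : X → X := fun x => ‖h x‖⁻¹ • h x
  have hρ : ContDiff ℝ 1 ρ := ((hd.norm ℝ h0).inv fun x => norm_ne_zero_iff.2 (h0 x)).smul hd
  have hρ1 : ∀ x, ‖ρ x‖ = 1 := fun x => by
    simp [ρ, norm_smul, norm_ne_zero_iff.2 (h0 x)]
  have hρs : ∀ x, ‖x‖ = 1 → ρ x = x := fun x hx => by simp [ρ, hid x hx.ge, hx]
  -- The displacement of the retraction `ρ` in the ball, extended by zero. It is continuous because
  -- `ρ` fixes the sphere; at the sphere it is Lipschitz but need not be differentiable.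
  let u : X → X := (ball 0 1).indicator fun x => ρ x - x
  have hus : ∀ x, 1 ≤ ‖x‖ → u x = 0 := fun x hx => indicator_of_notMem (by simpa using hx) _
  have huρ : ∀ x, ‖x‖ ≤ 1 → u x = ρ x - x := by
    intro x hx
    rcases hx.lt_or_eq with hx | hx
    · exact indicator_of_mem (by simpa using hx) _
    · rw [hus x hx.ge, hρs x hx, sub_self]
  obtain ⟨K, hK⟩ := ((hρ.sub contDiff_id).locallyLipschitz.locallyLipschitzOn
    (s := closedBall 0 1)).exists_lipschitzOnWith_of_compact (isCompact_closedBall (0 : X) 1)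
  have hu : LipschitzWith K u := by
    refine lipschitzWith_of_lipschitzOnWith_closedBall (r := 1) (fun x hx y hy => ?_) hus
    rw [huρ x (by simpa using hx), huρ y (by simpa using hy)]
    exact hK hx hy
  have hder : ∀ x ∈ ball (0 : X) 1, HasFDerivAt u (fderiv ℝ ρ x - 1) x := by
    intro x hx
    have h1 : HasFDerivAt (fun x => ρ x - x) (fderiv ℝ ρ x - 1) x :=
      ((hρ.differentiable one_ne_zero x).hasFDerivAt).sub (hasFDerivAt_id x)
    refine h1.congr_of_eventuallyEq ?_
    filter_upwards [isOpen_ball.mem_nhds hx] with y hy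
    exact indicator_of_mem hy _
  have hvol := setIntegral_det_one_add_fderiv volume hu (isOpen_ball (x := (0 : X)) (ε := 1))
    measure_ball_lt_top.ne (fun x hx => hus x (by simpa using hx))
    (fun x hx => (hder x hx).differentiableAt.differentiableWithinAt)
  rw [setIntegral_congr_fun measurableSet_ball (g := fun _ => (0 : ℝ)), integral_zero] at hvol
  · exact (ENNReal.toReal_pos (measure_ball_pos volume (0 : X) one_pos).ne'
      measure_ball_lt_top.ne).ne hvol
  · intro x hx
    simp only
    rw [(hder x hx).fderiv, add_sub_cancel]
    exact det_fderiv_eq_zero_of_norm_eq_one (hρ.differentiable one_ne_zero x).hasFDerivAt hρ1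

/-- A form of Brouwer's theorem: a continuous map of the closed unit ball that moves points by at
most `1 / 2` has a zero. -/
theorem exists_eq_zero_of_continuousOn_closedBall_one {X : Type*} [NormedAddCommGroup X]
    [InnerProductSpace ℝ X] [FiniteDimensional ℝ X] {f : X → X}
    (hf : ContinuousOn f (closedBall 0 1)) (hb : ∀ x ∈ closedBall (0 : X) 1, ‖f x - x‖ ≤ 1 / 2) :
    ∃ x ∈ closedBall (0 : X) 1, f x = 0 := by
  by_contra! h0
  have hK := isCompact_closedBall (0 : X) 1
  obtain ⟨x₀, hx₀, hmin⟩ := hK.exists_isMinOn ⟨0, by simp⟩ hf.norm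
  have hδ : 0 < ‖f x₀‖ := norm_pos_iff.2 (h0 x₀ hx₀)
  obtain ⟨W, hW⟩ := ContinuousMap.exists_restrict_eq isClosed_closedBall
    (⟨fun x : closedBall (0 : X) 1 => f x - x,
      (continuousOn_iff_continuous_domRestrict.1 (hf.sub continuousOn_id))⟩ :
      C(closedBall (0 : X) 1, X))
  have hWf : ∀ x ∈ closedBall (0 : X) 1, W x = f x - x := fun x hx =>
    congrArg (fun g : C(closedBall (0 : X) 1, X) => g ⟨x, hx⟩) hW
  -- A smooth approximation `g` of the displacement of `f`: closer than the minimum of `‖f‖`, so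
  -- that `x + g x` has no zero if `f` has none, and closer than `1 / 8`, so that `‖g‖ < 5 / 8` on
  -- the ball.
  obtain ⟨g, hg, hgW⟩ : ∃ g : X → X, ContDiff ℝ ∞ g ∧
      ∀ x ∈ closedBall (0 : X) 1, dist (W x) (g x) < min (‖f x₀‖) (1 / 8) := by
    have h1 := ContinuousMap.dense_setOfPred_contDiff (E := X) (F := X) W
    rw [mem_closure_iff_nhds_basis
      (nhds_basis_uniformity uniformity_basis_dist.compactConvergenceUniformity)] at h1
    obtain ⟨g, hg, hgW⟩ := h1 (closedBall 0 1, min (‖f x₀‖) (1 / 8)) ⟨hK, by positivity⟩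
    exact ⟨g, hg, fun x hx => by simpa [dist_comm] using hgW x hx⟩
  -- Cutting `g` off on the shell `3 / 4 ≤ ‖x‖ ≤ 1` creates no zero there, since `5 / 8 < 3 / 4`.
  let b : ContDiffBump (0 : X) := ⟨3 / 4, 1, by norm_num, by norm_num⟩
  obtain ⟨x, hx⟩ := exists_eq_zero_of_contDiff (h := fun x => x + b x • g x)
    (contDiff_id.add (b.contDiff.smul (hg.of_le (by simp))))
    (fun x hx => by simp [b.zero_of_le_dist (x := x) (by simpa [b] using hx)])
  by_cases hx1 : 1 ≤ ‖x‖
  · rw [b.zero_of_le_dist (by simpa [b] using hx1), zero_smul, add_zero] at hx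
    simp [hx] at hx1
    linarith
  have hxb : x ∈ closedBall (0 : X) 1 := by simpa using (not_le.1 hx1).le
  have hgx := hgW x hxb
  rw [hWf x hxb, dist_eq_norm, lt_min_iff] at hgx
  by_cases hx2 : ‖x‖ ≤ 3 / 4
  · rw [b.one_of_mem_closedBall (by simpa [b] using hx2), one_smul] at hx
    have h1 : f x - x - g x = f x := by
      rw [sub_sub, hx, sub_zero]
    rw [h1] at hgx
    exact (hmin hxb).not_gt hgx.1
  · have h1 : ‖x‖ = b x * ‖g x‖ := by
      rw [← Real.norm_of_nonneg (b.nonneg (x := x)), ← norm_smul, ← norm_neg (b x • g x)]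
      exact congrArg norm (eq_neg_of_add_eq_zero_left hx)
    have h2 : ‖g x‖ ≤ ‖f x - x‖ + ‖f x - x - g x‖ := by
      have := norm_sub_le (f x - x) (f x - x - g x)
      simpa using this
    have h3 := hb x hxb
    have h4 : b x * ‖g x‖ ≤ ‖g x‖ := mul_le_of_le_one_left (norm_nonneg _) b.le_one
    linarith [hgx.2]

theorem exists_eq_zero_of_continuousOn_closedBall {X : Type*} [NormedAddCommGroup X]
    [InnerProductSpace ℝ X] [FiniteDimensional ℝ X] {f : X → X} {r : ℝ} (hr : 0 < r)
    (hf : ContinuousOn f (closedBall 0 r)) (hb : ∀ x ∈ closedBall (0 : X) r, ‖f x - x‖ ≤ r / 2) :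
    ∃ x ∈ closedBall (0 : X) r, f x = 0 := by
  have hmaps : MapsTo (fun x : X => r • x) (closedBall 0 1) (closedBall 0 r) := by
    intro x hx
    rw [mem_closedBall_zero_iff] at hx ⊢
    rw [norm_smul, Real.norm_of_nonneg hr.le]
    exact mul_le_of_le_one_right hr.le hx
  obtain ⟨x, hx, hx0⟩ := exists_eq_zero_of_continuousOn_closedBall_one
    (f := fun x => r⁻¹ • f (r • x)) ((hf.comp (by fun_prop) hmaps).const_smul r⁻¹) (by
      intro x hx
      have h1 : r⁻¹ • f (r • x) - x = r⁻¹ • (f (r • x) - r • x) := by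
        rw [smul_sub, inv_smul_smul₀ hr.ne']
      rw [h1, norm_smul, Real.norm_of_nonneg (inv_nonneg.2 hr.le), inv_mul_le_iff₀ hr]
      linarith [hb _ (hmaps hx)])
  exact ⟨r • x, hmaps hx, by simpa [hr.ne'] using hx0⟩

/-- A zero at which the derivative is the identity persists under perturbations that are merely
continuous in the parameter and in the space variable jointly. -/
theorem eventually_exists_eq_zero_of_hasFDerivAt_id {A X : Type*} [TopologicalSpace A]
    [NormedAddCommGroup X]
    [InnerProductSpace ℝ X] [FiniteDimensional ℝ X] {g : A × X → X} {a₀ : A} {S : Set (A × X)}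
    (hS : IsOpen S) (hmem : (a₀, (0 : X)) ∈ S) (hg : ContinuousOn g S) (h0 : g (a₀, 0) = 0)
    (hd : HasFDerivAt (fun x => g (a₀, x)) (ContinuousLinearMap.id ℝ X) 0) :
    ∀ᶠ a in 𝓝 a₀, ∃ x, (a, x) ∈ S ∧ g (a, x) = 0 := by
  have h1 : ∀ᶠ x in 𝓝 (0 : X), ‖g (a₀, x) - x‖ ≤ 1 / 4 * ‖x‖ := by
    have := hd.isLittleO.def (c := 1 / 4) (by norm_num)
    simpa [h0] using this
  have h2 : ∀ᶠ x in 𝓝 (0 : X), (a₀, x) ∈ S :=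
    (Continuous.prodMk_right a₀).continuousAt.eventually (hS.mem_nhds hmem)
  obtain ⟨r, hr, hball⟩ := nhds_basis_closedBall.eventually_iff.1 (h1.and h2)
  -- The bound on the displacement passes from `a₀` to nearby `a`, uniformly on the compact ball.
  have h3 : ∀ᶠ a in 𝓝 a₀, ∀ x ∈ closedBall (0 : X) r, (a, x) ∈ S ∧ ‖g (a, x) - x‖ < r / 2 := by
    refine (isCompact_closedBall (0 : X) r).eventually_forall_of_forall_eventually fun x hx => ?_
    have hxS := (hball hx).2
    have hc : ContinuousAt (fun z : A × X => ‖g z - z.2‖) (a₀, x) :=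
      ((hg.continuousAt (hS.mem_nhds hxS)).sub continuousAt_snd).norm
    have hlt : ‖g (a₀, x) - x‖ < r / 2 := by
      have := (hball hx).1
      have hxr : ‖x‖ ≤ r := by simpa using hx
      linarith
    filter_upwards [hS.mem_nhds hxS, hc.eventually_lt_const hlt] with z hz1 hz2
    exact ⟨hz1, hz2⟩
  filter_upwards [h3] with a ha
  obtain ⟨x, hx, hx0⟩ := exists_eq_zero_of_continuousOn_closedBall hr (f := fun x => g (a, x))
    (hg.comp (by fun_prop) fun x hx => (ha x hx).1) (fun x hx => (ha x hx).2.le)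
  exact ⟨x, (ha x hx).1, hx0⟩

/-! ### Surjective derivatives, charts and transversality -/

/-- A zero at which the derivative onto a finite-dimensional space is surjective persists under
continuous perturbations: restrict to the affine image of a right inverse of the derivative. -/
theorem eventually_exists_eq_zero_of_hasFDerivAt_surjective {A V Y : Type*} [TopologicalSpace A]
    [NormedAddCommGroup V] [NormedSpace ℝ V] [NormedAddCommGroup Y] [NormedSpace ℝ Y]
    [FiniteDimensional ℝ Y] {g : A × V → Y} {a₀ : A} {v₀ : V} {S : Set (A × V)}
    (hS : IsOpen S) (hmem : (a₀, v₀) ∈ S) (hg : ContinuousOn g S) (h0 : g (a₀, v₀) = 0)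
    {D : V →L[ℝ] Y} (hd : HasFDerivAt (fun v => g (a₀, v)) D v₀) (hD : Function.Surjective D) :
    ∀ᶠ a in 𝓝 a₀, ∃ v, (a, v) ∈ S ∧ g (a, v) = 0 := by
  let L : Y ≃L[ℝ] EuclideanSpace ℝ (Fin (Module.finrank ℝ Y)) := toEuclidean
  obtain ⟨R, hR⟩ := (D : V →ₗ[ℝ] Y).exists_rightInverse_of_surjective (LinearMap.range_eq_top.2 hD)
  let R' : Y →L[ℝ] V := LinearMap.toContinuousLinearMap R
  have hR' : ∀ y, D (R' y) = y := fun y => congrArg (fun B : Y →ₗ[ℝ] Y => B y) hR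
  let j : EuclideanSpace ℝ (Fin (Module.finrank ℝ Y)) → V := fun x => v₀ + R' (L.symm x)
  have hj0 : j 0 = v₀ := by simp [j]
  let R₁ : EuclideanSpace ℝ (Fin (Module.finrank ℝ Y)) →L[ℝ] V :=
    R'.comp L.symm.toContinuousLinearMap
  have hj : HasFDerivAt j R₁ 0 := R₁.hasFDerivAt.const_add v₀
  have hjc : Continuous j := by fun_prop
  let ψ : A × EuclideanSpace ℝ (Fin (Module.finrank ℝ Y)) → A × V := fun z => (z.1, j z.2)
  have hψ : Continuous ψ := by fun_prop
  have key := eventually_exists_eq_zero_of_hasFDerivAt_id (a₀ := a₀) (g := fun z => L (g (ψ z)))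
    (hS.preimage hψ) (by simpa [ψ, hj0] using hmem)
    (L.continuous.comp_continuousOn (hg.comp hψ.continuousOn fun z hz => hz))
    (by simp [ψ, hj0, h0]) (by
      have h1 : HasFDerivAt (fun x => g (a₀, j x)) (D.comp R₁) 0 :=
        HasFDerivAt.comp (g := fun v => g (a₀, v)) 0 (by rw [hj0]; exact hd) hj
      have h2 := L.toContinuousLinearMap.hasFDerivAt.comp 0 h1
      have h3 : L.toContinuousLinearMap.comp (D.comp R₁) = ContinuousLinearMap.id ℝ _ := by
        ext1 x
        simp [R₁, hR']
      rw [h3] at h2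
      exact h2)
  filter_upwards [key] with a ha
  obtain ⟨x, hx, hx0⟩ := ha
  exact ⟨j x, hx, by simpa using hx0⟩

/-- In a chart that flattens `Q` to the subspace `G`, vectors tangent to `Q` have no component in
the normal directions `E ⧸ G`. -/
theorem mkQL_mfderiv_eq_zero_of_mem_submanifoldTangentSpace {E : Type*} [NormedAddCommGroup E]
    [NormedSpace ℝ E] {N : Type*} [TopologicalSpace N] [ChartedSpace E N]
    {Q : Set N} {q : N} {φ : OpenPartialHomeomorph N E} (hq : q ∈ φ.source)
    (hφ : MDifferentiableAt 𝓘(ℝ, E) 𝓘(ℝ, E) φ q)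
    {G : Submodule ℝ E} [IsClosed (G : Set E)] (hG : ∀ x ∈ φ.source, x ∈ Q ↔ φ x ∈ G)
    {w : TangentSpace 𝓘(ℝ, E) q} (hw : w ∈ submanifoldTangentSpace (E := E) Q q) :
    G.mkQL (mfderiv 𝓘(ℝ, E) 𝓘(ℝ, E) φ q w) = 0 := by
  obtain ⟨γ, rfl, hγ, hγQ, rfl⟩ := hw
  have hγ' := (hγ.mdifferentiableAt one_ne_zero).hasMFDerivAt
  have h1 : HasFDerivAt (φ ∘ γ) _ (0 : ℝ) :=
    hasMFDerivAt_iff_hasFDerivAt.1 (HasMFDerivAt.comp (0 : ℝ) hφ.hasMFDerivAt hγ')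
  have h2 := G.mkQL.hasFDerivAt.comp (0 : ℝ) h1
  have h3 : HasFDerivAt (G.mkQL ∘ (φ ∘ γ)) (0 : ℝ →L[ℝ] E ⧸ G) 0 := by
    refine (hasFDerivAt_const (0 : E ⧸ G) (0 : ℝ)).congr_of_eventuallyEq ?_
    filter_upwards [hγQ, hγ.continuousAt.eventually (φ.open_source.mem_nhds hq)] with t ht hts
    simpa using (hG _ hts).1 ht
  exact congrArg (fun B : ℝ →L[ℝ] E ⧸ G => B 1) (h2.unique h3)

/-- Transversality to `Q` in a chart flattening `Q` to `G`: a set of tangent vectors that spans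
together with the tangent space of `Q` maps onto `E ⧸ G`. -/
theorem exists_mem_mkQL_mfderiv_eq {E : Type*} [NormedAddCommGroup E]
    [NormedSpace ℝ E] {N : Type*} [TopologicalSpace N] [ChartedSpace E N]
    {Q : Set N} {q : N} {φ : OpenPartialHomeomorph N E} (hq : q ∈ φ.source)
    (hφ : φ.MDifferentiable 𝓘(ℝ, E) 𝓘(ℝ, E))
    {G : Submodule ℝ E} [IsClosed (G : Set E)] (hG : ∀ x ∈ φ.source, x ∈ Q ↔ φ x ∈ G)
    {T : Set (TangentSpace 𝓘(ℝ, E) q)}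
    (hT : T + submanifoldTangentSpace (E := E) Q q = univ) (y : E ⧸ G) :
    ∃ w ∈ T, G.mkQL (mfderiv 𝓘(ℝ, E) 𝓘(ℝ, E) φ q w) = y := by
  obtain ⟨z, rfl⟩ := G.mkQ_surjective y
  obtain ⟨w, rfl⟩ := hφ.mfderiv_surjective hq z
  obtain ⟨w₁, hw₁, w₂, hw₂, rfl⟩ : w ∈ T + submanifoldTangentSpace (E := E) Q q := hT ▸ mem_univ w
  refine ⟨w₁, hw₁, ?_⟩
  have h := mkQL_mfderiv_eq_zero_of_mem_submanifoldTangentSpace hq (hφ.mdifferentiableAt hq) hG hw₂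
  let B : TangentSpace 𝓘(ℝ, E) q →L[ℝ] E ⧸ G := G.mkQL.comp (mfderiv 𝓘(ℝ, E) 𝓘(ℝ, E) φ q)
  have hB : B (w₁ + w₂) = B w₁ := by
    rw [map_add, show B w₂ = 0 from h, add_zero]
  exact hB.symm

/-- Surjectivity of the derivative at `p` can be checked in the preferred chart at `p`. -/
theorem exists_hasFDerivAt_comp_chartAt_symm {V Y P : Type*} [NormedAddCommGroup V]
    [NormedSpace ℝ V] [NormedAddCommGroup Y] [NormedSpace ℝ Y] [TopologicalSpace P]
    [ChartedSpace V P] [IsManifold 𝓘(ℝ, V) 1 P] {k : P → Y} {p : P}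
    {k' : TangentSpace 𝓘(ℝ, V) p →L[ℝ] Y}
    (hk : HasMFDerivAt 𝓘(ℝ, V) 𝓘(ℝ, Y) k p k') (hk' : Function.Surjective k') :
    ∃ D : V →L[ℝ] Y, HasFDerivAt (k ∘ (chartAt V p).symm) D (chartAt V p p) ∧
      Function.Surjective D := by
  set e := chartAt V p
  have hp : p ∈ e.source := mem_chart_source V p
  have hed : e.MDifferentiable 𝓘(ℝ, V) 𝓘(ℝ, V) := mdifferentiable_chart p
  have h1 : MDifferentiableAt 𝓘(ℝ, V) 𝓘(ℝ, Y) (k ∘ e.symm) (e p) :=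
    MDifferentiableAt.comp_of_eq (e p) hk.mdifferentiableAt
      (hed.mdifferentiableAt_symm (e.map_source hp)) (e.left_inv hp)
  refine ⟨_, hasMFDerivAt_iff_hasFDerivAt.1 h1.hasMFDerivAt, fun y => ?_⟩
  -- The derivative of `k` factors through that of `k ∘ e.symm`, which is thus surjective as well.
  have h2 := h1.hasMFDerivAt.comp p (hed.mdifferentiableAt hp).hasMFDerivAt
  have h3 : k =ᶠ[𝓝 p] (k ∘ e.symm) ∘ e := by
    filter_upwards [e.open_source.mem_nhds hp] with x hx
    simp [e.left_inv hx]
  obtain ⟨v, rfl⟩ := hk' y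
  have h4 := hasMFDerivAt_unique hk (h2.congr_of_eventuallyEq h3)
  rw [h4]
  exact ⟨_, rfl⟩

end

/-! ### Persistence of transverse intersections -/

theorem mainTheorem8
    -- the base and the fiber bundle, with typical fiber `F` and fibers `M a`
    {A : Type*} [TopologicalSpace A]
    {F : Type*} [TopologicalSpace F]
    {M : A → Type*} [∀ a, TopologicalSpace (M a)] [TopologicalSpace (TotalSpace F M)]
    [FiberBundle F M]
    -- the fibers are finite-dimensional manifolds
    {V : Type*} [NormedAddCommGroup V] [NormedSpace ℝ V] [FiniteDimensional ℝ V]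
    [∀ a, ChartedSpace V (M a)] [∀ a, IsManifold 𝓘(ℝ, V) 1 (M a)]
    -- the Banach manifold and its submanifold
    {E : Type*} [NormedAddCommGroup E] [NormedSpace ℝ E] [CompleteSpace E]
    {N : Type*} [TopologicalSpace N] [ChartedSpace E N] [IsManifold 𝓘(ℝ, E) 1 N]
    (Q : Set N) (hQ : IsBanachSubmanifold (E := E) 1 Q)
    (χ : TotalSpace F M → N) (hχ : Continuous χ)
    (a₀ : A) (p₀ : M a₀)
    (ha : χ ⟨a₀, p₀⟩ ∈ Q)
    (hb : ContMDiff 𝓘(ℝ, V) 𝓘(ℝ, E) 1 (fun p : M a₀ => χ ⟨a₀, p⟩))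
    (hc : Set.range (mfderiv 𝓘(ℝ, V) 𝓘(ℝ, E) (fun p : M a₀ => χ ⟨a₀, p⟩) p₀) +
      submanifoldTangentSpace (E := E) Q (χ ⟨a₀, p₀⟩) = Set.univ) :
    ∀ᶠ a in 𝓝 a₀, (Set.range (fun p : M a => χ ⟨a, p⟩) ∩ Q).Nonempty := by
  obtain ⟨φ, hφ, hq, G, hGc, hG⟩ := hQ _ ha
  have : IsClosed (G : Set E) := hGc
  have hφd : φ.MDifferentiable 𝓘(ℝ, E) 𝓘(ℝ, E) :=
    ⟨(contMDiffOn_of_mem_maximalAtlas hφ).mdifferentiableOn one_ne_zero,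
      (contMDiffOn_symm_of_mem_maximalAtlas hφ).mdifferentiableOn one_ne_zero⟩
  -- The component of `χ` normal to `Q`: where `χ` is in the chart, `k` vanishes iff `χ` is in `Q`.
  let k : M a₀ → E ⧸ G := fun p => G.mkQL (φ (χ ⟨a₀, p⟩))
  have hk := (G.mkQL.hasMFDerivAt (x := φ (χ ⟨a₀, p₀⟩))).comp p₀
    (HasMFDerivAt.comp p₀ (hφd.mdifferentiableAt hq).hasMFDerivAt
      (hb.mdifferentiable one_ne_zero p₀).hasMFDerivAt)
  obtain ⟨D, hD, hDs⟩ := exists_hasFDerivAt_comp_chartAt_symm (k := k) hk (by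
    intro y
    obtain ⟨_, ⟨v, rfl⟩, hv⟩ := exists_mem_mkQL_mfderiv_eq hq hφd hG hc y
    exact ⟨v, hv⟩)
  -- Transversality forces finite codimension, and thus allows a finite-dimensional argument.
  have hfin : FiniteDimensional ℝ (E ⧸ G) := Module.Finite.of_surjective (D : V →ₗ[ℝ] E ⧸ G) hDs
  let e := chartAt V p₀
  let t := trivializationAt F M a₀
  have ha₀ : a₀ ∈ t.baseSet := mem_baseSet_trivializationAt F M a₀
  have hp₀ : p₀ ∈ e.source := mem_chart_source V p₀
  -- A trivialization moves the chart of `M a₀` to the nearby fibers. It is only continuous in `a`,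
  -- and on these fibers only continuous in the space variable; at `a₀` it is the chart itself.
  let m : A × V → TotalSpace F M := fun z =>
    t.toOpenPartialHomeomorph.symm (z.1, (t ⟨a₀, e.symm z.2⟩).2)
  have hmproj : ∀ a ∈ t.baseSet, ∀ v, (m (a, v)).proj = a := fun a h v => t.proj_symm_apply' h
  have hm₀ : ∀ v, m (a₀, v) = ⟨a₀, e.symm v⟩ := fun v =>
    t.symm_apply_mk_proj (x := ⟨a₀, e.symm v⟩) (t.mem_source.2 ha₀)
  have hmc : ContinuousOn m (t.baseSet ×ˢ e.target) := by
    refine t.toOpenPartialHomeomorph.continuousOn_symm.comp (continuousOn_fst.prodMk ?_)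
      fun z hz => t.mem_target.2 hz.1
    refine continuous_snd.comp_continuousOn (t.continuousOn.comp
      ((FiberBundle.continuous_totalSpaceMk F M a₀).comp_continuousOn
        (e.continuousOn_symm.comp continuousOn_snd fun z hz => hz.2))
      fun z _ => t.mem_source.2 ha₀)
  have hχm := hχ.comp_continuousOn hmc
  have key := eventually_exists_eq_zero_of_hasFDerivAt_surjective
    (g := fun z => G.mkQL (φ (χ (m z)))) (a₀ := a₀) (v₀ := e p₀)
    (hχm.isOpen_inter_preimage (t.open_baseSet.prod e.open_target) φ.open_source)
    ⟨⟨ha₀, e.map_source hp₀⟩, by simpa [hm₀, e.left_inv hp₀] using hq⟩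
    (G.mkQL.continuous.comp_continuousOn
      (φ.continuousOn.comp (hχm.mono inter_subset_left) fun z hz => hz.2))
    (by simpa [hm₀, e.left_inv hp₀] using (hG _ hq).1 ha)
    (D := D) (by simp only [hm₀]; exact hD) hDs
  filter_upwards [key, t.open_baseSet.mem_nhds ha₀] with a ⟨v, hvS, hv0⟩ hat
  have hproj := hmproj a hat v
  refine ⟨χ (m (a, v)), ?_, (hG _ hvS.2).2 (by simpa using hv0)⟩
  generalize m (a, v) = z at hproj
  obtain ⟨b, p⟩ := z
  obtain rfl : b = a := hproj
  exact mem_range_self p
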